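/- Let $d\ge 1$. A random centered tree of depth $k\ge 1$ on $[0,1]^d$ is obtained by starting from the cube and performing $k$ rounds of splitting: in each round every current cell is cut at the midpoint of its side along a coordinate drawn uniformly from $\{1,\dots,d\}$, all these draws being independent; points on a cut are assigned to the lower half. For such a tree $\Theta$ let $A(x,\Theta)$ be the one of the $2^k$ final cells that contains $x$. Given data $(X_1,Y_1),\dots,(X_n,Y_n)$ and independent random centered trees $\Theta_1,\Theta_2,\dots$ of depth $k$, independent of the data, the infinite centered KeRF estimator is $$\tilde m^{Cen}_{\infty,n}(x)=\lim_{M\to\infty}\frac{\sum_{j=1}^M\sum_{i=1}^n Y_i\,\mathbf 1_{X_i\in A(x,\Theta_j)}}{\sum_{j=1}^M\sum_{i=1}^n \mathbf 1_{X_i\in A(x,\Theta_j)}}\qquad (0/0:=0).$$ **Theorem 1.** For every $d\ge1$ there are depths $k(n)\ge 1$, $n\ge 1$, depending only on $n$ and $d$, with $k(n)\to\infty$ as $n\to\infty$ and, for all $n\ge 3$, $$k(n)=\left\lceil \frac{\frac1{\log n}-1}{2\log_2\left(1-\frac1{2d}\right)-\left(1-\frac1{\log n}\right)}\;\log_2\frac{n}{(\log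 n)^{\frac{1/\log n}{1-1/\log n}}}\right\rceil ,$$ such that the following holds. Let $m:[0,1]^d\to\mathbb R$ be Lipschitz with respect to $\|x-y\|=\sum_{j=1}^d|x_j-y_j|$ and let $\sigma^2\in[0,\infty)$. Then there is a constant $\tilde C$, depending only on $d$, $m$ and $\sigma^2$, such that for every $n>1$ and every $x\in[0,1]^d$: if the pairs $(X_i,\varepsilon_i)$, $i=1,\dots,n$, are independent, with $X_i$ uniform on $[0,1]^d$, $\varepsilon_i\sim N(0,\sigma^2)$ independent of $X_i$, and $Y_i=m(X_i)+\varepsilon_i$, then the limit defining the infinite centered KeRF estimator with trees of depth $k(n)$ exists almost surely, $\tilde m^{Cen}_{\infty,n}(x)-m(x)$ is square integrable, and $$\mathbb E\left(\tilde m^{Cen}_{\infty,n}(x)-m(x)\right)^2\le \tilde C\, n^{-\frac1{1+d\log 2}}\,\log n .$$ -/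

import Mathlib

open MeasureTheory ProbabilityTheory Filter Topology
open scoped NNReal

/-- A centered tree of depth `k` in dimension `d`: every internal node carries the coordinate along
which its box is cut at the midpoint; `lo` and `hi` are the trees grown on the lower and on the
upper half. It has `2 ^ k` leaves. -/
inductive CenteredTree (d : ℕ) : ℕ → Type
  | leaf : CenteredTree d 0
  | node {k : ℕ} (j : Fin d) (lo hi : CenteredTree d k) : CenteredTree d (k + 1)

namespace CenteredTree

/-- There are finitely many trees of a given depth; every set of trees is measurable. -/
instance (d k : ℕ) : MeasurableSpace (CenteredTree d k) := ⊤

/-- The law of a random centered tree of depth `k`: the coordinates at all the nodes are independent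
and uniformly distributed in `Fin d`. -/
noncomputable def law (d : ℕ) [NeZero d] : (k : ℕ) → PMF (CenteredTree d k)
  | 0 => PMF.pure leaf
  | k + 1 =>
    (PMF.uniformOfFintype (Fin d)).bind fun j =>
      (law d k).bind fun lo => (law d k).bind fun hi => PMF.pure (node j lo hi)

/-- The constraints that the tree, grown on the box with lower corner `a` and upper corner `b`,
imposes on a point in order to fall in the same cell as `x`. A box is cut along the coordinate `j`
at the midpoint `c` of its `j`-th side; points on the cut belong to the lower half. -/
noncomputable def cellFrom {d : ℕ} : {k : ℕ} → CenteredTree d k →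
    (a b x : Fin d → ℝ) → Set (Fin d → ℝ)
  | _, leaf, _, _, _ => Set.univ
  | _, node j lo hi, a, b, x =>
    let c : ℝ := (a j + b j) / 2
    if x j ≤ c then {z | z j ≤ c} ∩ lo.cellFrom a (Function.update b j c) x
    else {z | c < z j} ∩ hi.cellFrom (Function.update a j c) b x

/-- The cell containing `x` of the partition of the unit cube `[0,1]^d` generated by the tree. -/
noncomputable def cell {d k : ℕ} (T : CenteredTree d k) (x : Fin d → ℝ) : Set (Fin d → ℝ) :=
  Set.Icc 0 1 ∩ T.cellFrom 0 1 x

/-- The number of the data points `X 0, …, X (n - 1)` in the cell of `x`. -/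
noncomputable def count {d k n : ℕ} (T : CenteredTree d k) (X : Fin n → Fin d → ℝ)
    (x : Fin d → ℝ) : ℝ :=
  ∑ i, (T.cell x).indicator (fun _ => (1 : ℝ)) (X i)

end CenteredTree

/-- The centered KeRF estimate at `x` built on the data `(X i, Y i)`, `i < n`, with the first `M`
trees of the sequence `Θ` (it is `0` if no cell of `x` contains a data point). -/
noncomputable def finiteKeRF {d k n : ℕ} (X : Fin n → Fin d → ℝ) (Y : Fin n → ℝ)
    (Θ : ℕ → CenteredTree d k) (M : ℕ) (x : Fin d → ℝ) : ℝ :=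
  (∑ j ∈ Finset.range M, ∑ i, Y i * ((Θ j).cell x).indicator (fun _ => (1 : ℝ)) (X i)) /
    ∑ j ∈ Finset.range M, (Θ j).count X x

/-- The infinite centered KeRF estimate: the limit as the number of trees tends to infinity. -/
noncomputable def infiniteKeRF {d k n : ℕ} (X : Fin n → Fin d → ℝ) (Y : Fin n → ℝ)
    (Θ : ℕ → CenteredTree d k) (x : Fin d → ℝ) : ℝ :=
  limUnder atTop fun M : ℕ => finiteKeRF X Y Θ M x

/-- `m` is Lipschitz on `[0,1]^d` with respect to the distance `∑ j, |x j - y j|`. -/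
def LipschitzOnCube {d : ℕ} (m : (Fin d → ℝ) → ℝ) : Prop :=
  ∃ L : ℝ, ∀ x ∈ Set.Icc (0 : Fin d → ℝ) 1, ∀ y ∈ Set.Icc (0 : Fin d → ℝ) 1,
    |m x - m y| ≤ L * ∑ j, |x j - y j|

/-!
For fixed data the strong law of large numbers, applied to the frequency of each of the finitely
many trees, shows that the finite forests converge almost surely to the weighted average
`(∑ i, K x (X i) * Y i) / ∑ i, K x (X i)`, where `K x z` (`connection`) is the probability that `x`
and `z` share a cell of a random tree (`tendsto_finiteKeRF`). It remains to bound the risk of this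
weighted average.

Put `s = n * ∫ K x`. Every cell of a tree of depth `k` has volume `2 ^ (-k)`, so `s = n / 2 ^ k`,
and since `0 ≤ K ≤ 1` the total weight `U = ∑ i, K x (X i)` satisfies `E (U - s) ^ 2 ≤ s`. No
separate treatment of the event that `U` is small is needed: where `U < s / 2`, the quantity
`4 * (U - s) ^ 2 / s ^ 2` is at least `1`, so pointwise bounds valid for `U ≥ s / 2` become valid
everywhere after adding a multiple of it (`weighted_average_error_sq_le`, `sum_sq_weights_le`). The
design is independent of the noise, so the noise contributes the noise variance times the expected
sum of the squared normalised weights. Altogether (`weighted_average_risk_le`) the risk is at most a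
constant times `1 / s + b ^ 2`, where `b` is the average of `‖z - x‖₁` under the density
proportional to `K x`. This average is at most the mean sum of the sides of the cell of `x`, and
each cut multiplies the mean of every side by `1 - 1 / (2 d)` (`CenteredTree.sum_weight_side`), so
the risk is of order `2 ^ k / n + (1 - 1 / (2 d)) ^ (2 k)` (`connection_average_risk_le`).

With `a = -2 * log₂ (1 - 1 / (2 d))` the depth differs from `log₂ n / (1 + a)` by a bounded amount
(`abs_depthReal_sub_le`), which makes both terms of order `n ^ (-a / (1 + a))`. Since
`a ≥ 1 / (d log 2)`, this is at most `n ^ (-1 / (1 + d log 2))` (`exists_variance_add_bias_le`); the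
factor `log n` of the theorem is not needed beyond being bounded below.
-/

/-! ### Averages over centered trees -/

namespace CenteredTree

/-- A tree of depth `k + 1` is the coordinate of its first cut together with two trees of
depth `k`. -/
def nodeEquiv (d k : ℕ) :
    Fin d × CenteredTree d k × CenteredTree d k ≃ CenteredTree d (k + 1) where
  toFun p := node p.1 p.2.1 p.2.2
  invFun
    | node j lo hi => (j, lo, hi)
  left_inv _ := rfl
  right_inv
    | node _ _ _ => rfl

/-- Trees of a given depth form a finite type. -/
noncomputable instance instFintype (d : ℕ) : (k : ℕ) → Fintype (CenteredTree d k)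
  | 0 => ⟨{leaf}, fun T => by cases T; simp⟩
  | k + 1 =>
    have := instFintype d k
    Fintype.ofEquiv _ (nodeEquiv d k)

theorem sum_depth_zero {d : ℕ} (f : CenteredTree d 0 → ℝ) : ∑ T, f T = f leaf := by
  have : (Finset.univ : Finset (CenteredTree d 0)) = {leaf} := by
    ext T
    cases T
    simp
  rw [this, Finset.sum_singleton]

theorem sum_depth_succ {d k : ℕ} (f : CenteredTree d (k + 1) → ℝ) :
    ∑ T, f T = ∑ j, ∑ lo, ∑ hi, f (node j lo hi) := by
  rw [← (nodeEquiv d k).sum_comp, Fintype.sum_prod_type]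
  simp_rw [Fintype.sum_prod_type]
  rfl

/-- The probability of the tree `T` under the law of a random centered tree. -/
noncomputable def weight {d k : ℕ} [NeZero d] (T : CenteredTree d k) : ℝ := (law d k T).toReal

section Weight

variable {d k : ℕ} [NeZero d]

theorem weight_leaf : weight (leaf : CenteredTree d 0) = 1 := by
  simp [weight, law]

theorem weight_node (j : Fin d) (lo hi : CenteredTree d k) :
    weight (node j lo hi) = (d : ℝ)⁻¹ * (weight lo * weight hi) := by
  classical
  have h : law d (k + 1) (node j lo hi) = (d : ENNReal)⁻¹ * (law d k lo * law d k hi) := by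
    simp only [law, PMF.bind_apply, PMF.pure_apply, PMF.uniformOfFintype_apply, node.injEq,
      Fintype.card_fin]
    rw [tsum_eq_single j, tsum_eq_single lo, tsum_eq_single hi]
    · simp
    · intro b hb
      simp [hb.symm]
    · intro b hb
      simp [hb.symm]
    · intro b hb
      simp [hb.symm]
  simp [weight, h]

theorem weight_pos : ∀ {k : ℕ} (T : CenteredTree d k), 0 < weight T
  | _, leaf => by simp [weight_leaf]
  | _, node j lo hi => by
    rw [weight_node]
    have hd : (0 : ℝ) < d := Nat.cast_pos.2 (NeZero.pos d)
    have := weight_pos lo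
    have := weight_pos hi
    positivity

theorem sum_weight : ∑ T : CenteredTree d k, weight T = 1 := by
  have h := (law d k).tsum_coe
  rw [tsum_fintype] at h
  unfold weight
  rw [← ENNReal.toReal_sum fun T _ => (law d k).apply_ne_top T, h, ENNReal.toReal_one]

/-- Averaging over a random tree: average over the first cut and the two independent subtrees. -/
theorem sum_weight_succ (f : CenteredTree d (k + 1) → ℝ) :
    ∑ T, weight T * f T =
      (d : ℝ)⁻¹ * ∑ j, ∑ lo, weight lo * ∑ hi, weight hi * f (node j lo hi) := by
  rw [sum_depth_succ, Finset.mul_sum]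
  simp_rw [weight_node, Finset.mul_sum]
  refine Finset.sum_congr rfl fun j _ => Finset.sum_congr rfl fun lo _ =>
    Finset.sum_congr rfl fun hi _ => by ring

end Weight

/-! ### Geometry of the cells -/

theorem measurableSet_cellFrom {d : ℕ} : ∀ {k : ℕ} (T : CenteredTree d k) (a b x : Fin d → ℝ),
    MeasurableSet (T.cellFrom a b x)
  | _, leaf, _, _, _ => MeasurableSet.univ
  | _, node j lo hi, a, b, x => by
    simp only [cellFrom]
    split_ifs
    · exact (measurableSet_le (measurable_pi_apply j) measurable_const).inter
        (measurableSet_cellFrom lo _ _ _)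
    · exact (measurableSet_lt measurable_const (measurable_pi_apply j)).inter
        (measurableSet_cellFrom hi _ _ _)

theorem measurableSet_cell {d k : ℕ} (T : CenteredTree d k) (x : Fin d → ℝ) :
    MeasurableSet (T.cell x) :=
  measurableSet_Icc.inter (T.measurableSet_cellFrom _ _ _)

/-- The side lengths of the cell of `x` in the partition that the tree generates on the box with
lower corner `a` and upper corner `b`. -/
noncomputable def side {d : ℕ} : {k : ℕ} → CenteredTree d k →
    (a b x : Fin d → ℝ) → Fin d → ℝ
  | _, leaf, a, b, _ => b - a
  | _, node j lo hi, a, b, x =>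
    let c : ℝ := (a j + b j) / 2
    if x j ≤ c then lo.side a (Function.update b j c) x else hi.side (Function.update a j c) b x

theorem abs_sub_le_side {d : ℕ} : ∀ {k : ℕ} (T : CenteredTree d k) {a b x z : Fin d → ℝ},
    x ∈ Set.Icc a b → z ∈ Set.Icc a b → z ∈ T.cellFrom a b x → ∀ i, |z i - x i| ≤ T.side a b x i
  | _, leaf, a, b, x, z, hx, hz, _, i => by
    have h₁ := hx.1 i
    have h₂ := hx.2 i
    have h₃ := hz.1 i
    have h₄ := hz.2 i
    simp only [side, Pi.sub_apply]
    exact abs_sub_le_iff.2 ⟨by linarith, by linarith⟩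
  | _, node j lo hi, a, b, x, z, hx, hz, hzT, i => by
    simp only [cellFrom, side] at hzT ⊢
    split_ifs at hzT ⊢ with h
    · refine abs_sub_le_side lo ⟨hx.1, ?_⟩ ⟨hz.1, ?_⟩ hzT.2 i
      · exact le_update_iff.2 ⟨h, fun l _ => hx.2 l⟩
      · exact le_update_iff.2 ⟨hzT.1, fun l _ => hz.2 l⟩
    · refine abs_sub_le_side hi ⟨?_, hx.2⟩ ⟨?_, hz.2⟩ hzT.2 i
      · exact update_le_iff.2 ⟨(not_le.1 h).le, fun l _ => hx.1 l⟩
      · exact update_le_iff.2 ⟨le_of_lt hzT.1, fun l _ => hz.1 l⟩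

/-- Halving the box at a uniformly chosen coordinate multiplies each side by `1 - 1 / (2 d)` on
average: the side is halved with probability `1 / d` and kept otherwise. -/
theorem sum_weight_side {d : ℕ} [NeZero d] : ∀ (k : ℕ) (a b x : Fin d → ℝ) (i : Fin d),
    ∑ T : CenteredTree d k, weight T * T.side a b x i = (1 - 1 / (2 * (d : ℝ))) ^ k * (b i - a i)
  | 0, a, b, x, i => by
    rw [sum_depth_zero, weight_leaf]
    simp [side]
  | k + 1, a, b, x, i => by
    have hd : (d : ℝ) ≠ 0 := Nat.cast_ne_zero.2 (NeZero.ne d)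
    have key : ∀ j : Fin d, (∑ lo : CenteredTree d k, weight lo * ∑ hi : CenteredTree d k,
        weight hi * (node j lo hi).side a b x i) =
        (1 - 1 / (2 * (d : ℝ))) ^ k * ((b i - a i) - if j = i then (b i - a i) / 2 else 0) := by
      intro j
      simp only [side]
      by_cases h : x j ≤ (a j + b j) / 2
      · simp only [h, if_true, ← Finset.sum_mul, sum_weight, one_mul]
        rw [sum_weight_side k]
        rcases eq_or_ne j i with rfl | hji
        · simp only [Function.update_self, if_true]
          ring
        · rw [Function.update_of_ne hji.symm, if_neg hji, sub_zero]
      · simp only [h, if_false]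
        rw [← Finset.sum_mul, sum_weight, one_mul, sum_weight_side k]
        rcases eq_or_ne j i with rfl | hji
        · simp only [Function.update_self, if_true]
          ring
        · rw [Function.update_of_ne hji.symm, if_neg hji, sub_zero]
    rw [sum_weight_succ]
    simp_rw [key, ← Finset.mul_sum, Finset.sum_sub_distrib]
    simp only [Finset.sum_const, Finset.card_univ, Fintype.card_fin, nsmul_eq_mul,
      Finset.sum_ite_eq', Finset.mem_univ, if_true, pow_succ]
    field_simp

/-- Every cut halves the volume of the cell, whichever half contains `x`. Half-open boxes are used
because cutting a half-open box at a midpoint yields half-open boxes again. -/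
theorem volume_Ioc_inter_cellFrom {d : ℕ} : ∀ {k : ℕ} (T : CenteredTree d k)
    {a b : Fin d → ℝ} (x : Fin d → ℝ), a ≤ b →
    (volume ((Set.univ.pi fun i => Set.Ioc (a i) (b i)) ∩ T.cellFrom a b x)).toReal =
      (1 / 2) ^ k * ∏ i, (b i - a i)
  | _, leaf, a, b, x, hab => by
    simp [cellFrom, Real.volume_pi_Ioc_toReal hab]
  | k + 1, node j lo hi, a, b, x, hab => by
    have hj := hab j
    have hprod : ∀ a' b' : Fin d → ℝ, b' j - a' j = (b j - a j) / 2 →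
        (∀ i, i ≠ j → b' i - a' i = b i - a i) →
        ∏ i, (b' i - a' i) = (1 / 2) * ∏ i, (b i - a i) := by
      intro a' b' h1 h2
      rw [← Finset.mul_prod_erase _ _ (Finset.mem_univ j), h1,
        ← Finset.mul_prod_erase _ (fun i => b i - a i) (Finset.mem_univ j),
        Finset.prod_congr rfl fun i hi => h2 i (Finset.ne_of_mem_erase hi)]
      ring
    simp only [cellFrom]
    split_ifs
    · have hset : (Set.univ.pi fun i => Set.Ioc (a i) (b i)) ∩ {z | z j ≤ (a j + b j) / 2} =
          Set.univ.pi fun i => Set.Ioc (a i) (Function.update b j ((a j + b j) / 2) i) := by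
        ext z
        simp only [Set.mem_inter_iff, Set.mem_univ_pi, Set.mem_Ioc, Set.mem_ofPred_eq]
        constructor
        · rintro ⟨h, hz⟩ i
          rcases eq_or_ne i j with rfl | hij
          · simpa using ⟨(h i).1, hz⟩
          · simpa [hij] using h i
        · intro h
          have h' := (h j).2
          rw [Function.update_self] at h'
          refine ⟨fun i => ?_, h'⟩
          rcases eq_or_ne i j with rfl | hij
          · exact ⟨(h i).1, by linarith⟩
          · simpa [hij] using h i
      rw [← Set.inter_assoc, hset, volume_Ioc_inter_cellFrom lo x, hprod, pow_succ]
      · ring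
      · rw [Function.update_self]
        ring
      · intro i hi
        rw [Function.update_of_ne hi]
      · exact le_update_iff.2 ⟨by linarith, fun l _ => hab l⟩
    · have hset : (Set.univ.pi fun i => Set.Ioc (a i) (b i)) ∩ {z | (a j + b j) / 2 < z j} =
          Set.univ.pi fun i => Set.Ioc (Function.update a j ((a j + b j) / 2) i) (b i) := by
        ext z
        simp only [Set.mem_inter_iff, Set.mem_univ_pi, Set.mem_Ioc, Set.mem_ofPred_eq]
        constructor
        · rintro ⟨h, hz⟩ i
          rcases eq_or_ne i j with rfl | hij
          · simpa using ⟨hz, (h i).2⟩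
          · simpa [hij] using h i
        · intro h
          have h' := (h j).1
          rw [Function.update_self] at h'
          refine ⟨fun i => ?_, h'⟩
          rcases eq_or_ne i j with rfl | hij
          · exact ⟨by linarith, (h i).2⟩
          · simpa [hij] using h i
      rw [← Set.inter_assoc, hset, volume_Ioc_inter_cellFrom hi x, hprod, pow_succ]
      · ring
      · rw [Function.update_self]
        ring
      · intro i hi
        rw [Function.update_of_ne hi]
      · exact update_le_iff.2 ⟨by linarith, fun l _ => hab l⟩

theorem volume_real_cell {d k : ℕ} (T : CenteredTree d k) (x : Fin d → ℝ) :
    volume.real (T.cell x) = (1 / 2) ^ k := by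
  have h := volume_Ioc_inter_cellFrom T x (zero_le_one : (0 : Fin d → ℝ) ≤ 1)
  have hae : (Set.univ.pi fun i : Fin d => Set.Ioc ((0 : Fin d → ℝ) i) ((1 : Fin d → ℝ) i))
      =ᵐ[volume] Set.Icc 0 1 := Measure.univ_pi_Ioc_ae_eq_Icc
  have hcell := measure_congr (hae.inter (ae_eq_refl (T.cellFrom 0 1 x)))
  rw [measureReal_def, cell, ← hcell]
  simpa using h

end CenteredTree

/-! ### The depth of the trees -/

/-- The real number whose ceiling is the depth of the trees for a sample of size `n`. -/
noncomputable def depthReal (d n : ℕ) : ℝ :=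
  (1 / Real.log n - 1) /
      (2 * Real.logb 2 (1 - 1 / (2 * (d : ℝ))) - (1 - 1 / Real.log n)) *
    Real.logb 2 ((n : ℝ) / Real.log n ^ ((1 / Real.log n) / (1 - 1 / Real.log n)))

/-- The depth of the trees for a sample of size `n`, set to `1` where the formula is not
meaningful. -/
noncomputable def depth (d n : ℕ) : ℕ := if n < 3 then 1 else ⌈depthReal d n⌉₊

/-- The decay rate of the squared mean diameter of a cell: it is `2 ^ (- biasExponent d * k)` for
trees of depth `k`, up to a constant. -/
noncomputable def biasExponent (d : ℕ) : ℝ := -2 * Real.logb 2 (1 - 1 / (2 * (d : ℝ)))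

theorem half_le_shrink {d : ℕ} [NeZero d] : 1 / 2 ≤ 1 - 1 / (2 * (d : ℝ)) := by
  have hd : (1 : ℝ) ≤ d := Nat.one_le_cast.2 (NeZero.pos d)
  have : 1 / (2 * (d : ℝ)) ≤ 1 / 2 := one_div_le_one_div_of_le (by norm_num) (by linarith)
  linarith

theorem one_le_biasExponent_mul {d : ℕ} [NeZero d] :
    1 ≤ biasExponent d * (d * Real.log 2) := by
  have hd : (1 : ℝ) ≤ d := Nat.one_le_cast.2 (NeZero.pos d)
  have h2 : 0 < Real.log 2 := Real.log_pos one_lt_two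
  have h := Real.log_le_sub_one_of_pos (half_le_shrink (d := d) |>.trans_lt' (by norm_num))
  have h' : biasExponent d * (d * Real.log 2) = -2 * d * Real.log (1 - 1 / (2 * (d : ℝ))) := by
    unfold biasExponent Real.logb
    field_simp
  rw [h']
  have h3 : (2 * d) * Real.log (1 - 1 / (2 * (d : ℝ))) ≤ (2 * d) * (- (1 / (2 * (d : ℝ)))) :=
    mul_le_mul_of_nonneg_left (by linarith) (by linarith)
  have h4 : (2 * d) * (- (1 / (2 * (d : ℝ)))) = -1 := by field_simp
  linarith

theorem biasExponent_pos {d : ℕ} [NeZero d] : 0 < biasExponent d := by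
  have hd : (1 : ℝ) ≤ d := Nat.one_le_cast.2 (NeZero.pos d)
  have h2 : 0 < Real.log 2 := Real.log_pos one_lt_two
  have h := one_le_biasExponent_mul (d := d)
  exact pos_of_mul_pos_left (by linarith) (by positivity : 0 ≤ d * Real.log 2)

theorem shrink_sq_pow {d : ℕ} [NeZero d] (k : ℕ) :
    (1 - 1 / (2 * (d : ℝ))) ^ (2 * k) = (2 : ℝ) ^ (-biasExponent d * k) := by
  have h : 0 < 1 - 1 / (2 * (d : ℝ)) := half_le_shrink.trans_lt' (by norm_num)
  have : -biasExponent d * k = Real.logb 2 (1 - 1 / (2 * (d : ℝ))) * ((2 * k : ℕ) : ℝ) := by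
    unfold biasExponent
    push_cast
    ring
  rw [this, Real.rpow_mul zero_le_two, Real.rpow_logb zero_lt_two (by norm_num) h,
    Real.rpow_natCast]

theorem one_lt_log_of_three_le {n : ℕ} (hn : 3 ≤ n) : 1 < Real.log n := by
  rw [Real.lt_log_iff_exp_lt (by positivity)]
  have : (3 : ℝ) ≤ n := by exact_mod_cast hn
  exact (Real.exp_one_lt_d9.trans (by norm_num)).trans_le this

theorem depthReal_eq {d n : ℕ} [NeZero d] (hn : 3 ≤ n) :
    depthReal d n = (Real.log n - 1 - Real.log (Real.log n) / Real.log n) /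
      (Real.log 2 * (biasExponent d + 1 - 1 / Real.log n)) := by
  have hL := one_lt_log_of_three_le hn
  have hn0 : (0 : ℝ) < n := by positivity
  have h2 : 0 < Real.log 2 := Real.log_pos one_lt_two
  have ha := biasExponent_pos (d := d)
  set L := Real.log n with hLdef
  have hδ : 1 / L < 1 := by rw [div_lt_one (by linarith)]; exact hL
  have hden : 2 * Real.logb 2 (1 - 1 / (2 * (d : ℝ))) - (1 - 1 / L) =
      -(biasExponent d + 1 - 1 / L) := by
    unfold biasExponent
    ring
  have hD : biasExponent d + 1 - 1 / L ≠ 0 := by linarith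
  have hL1 : 1 - 1 / L ≠ 0 := by linarith
  have hL2 : L - 1 ≠ 0 := by linarith
  unfold depthReal
  rw [← hLdef, hden, Real.logb, Real.log_div hn0.ne' (by positivity),
    Real.log_rpow (by linarith), ← hLdef]
  generalize biasExponent d + 1 - 1 / L = D at *
  have : 1 / L / (1 - 1 / L) = 1 / (L - 1) := by field_simp
  rw [this]
  field_simp
  ring

theorem depthReal_pos {d n : ℕ} [NeZero d] (hn : 3 ≤ n) : 0 < depthReal d n := by
  have hL := one_lt_log_of_three_le hn
  have h2 : 0 < Real.log 2 := Real.log_pos one_lt_two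
  have ha := biasExponent_pos (d := d)
  have hδ : 1 / Real.log n < 1 := by rw [div_lt_one (by linarith)]; exact hL
  rw [depthReal_eq hn]
  refine div_pos ?_ (mul_pos h2 (by linarith))
  have h3 := Real.log_le_sub_one_of_pos (x := Real.log n) (by linarith)
  have h4 : Real.log (Real.log n) / Real.log n < Real.log (Real.log n) :=
    div_lt_self (Real.log_pos hL) hL
  linarith

/-- The corrections by `1 / log n` in the formula for the depth change it by a bounded amount
only. -/
theorem abs_depthReal_sub_le {d n : ℕ} [NeZero d] (hn : 3 ≤ n) :
    |depthReal d n - Real.logb 2 n / (1 + biasExponent d)| ≤ 2 / (biasExponent d * Real.log 2) := by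
  have hL := one_lt_log_of_three_le hn
  have h2 : 0 < Real.log 2 := Real.log_pos one_lt_two
  have ha := biasExponent_pos (d := d)
  have hδ : 1 / Real.log n < 1 := by rw [div_lt_one (by linarith)]; exact hL
  rw [depthReal_eq hn, Real.logb]
  set L := Real.log n
  set a := biasExponent d
  have hl0 : 0 ≤ Real.log L / L := div_nonneg (Real.log_pos hL).le (by linarith)
  have hl1 : Real.log L / L ≤ 1 := by
    rw [div_le_one (by linarith)]
    linarith [Real.log_le_sub_one_of_pos (x := L) (by linarith)]
  set l := Real.log L / L
  have hD : 0 < a + 1 - 1 / L := by linarith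
  have hD' : a ≤ a + 1 - 1 / L := by linarith
  have hid : (L - 1 - l) / (Real.log 2 * (a + 1 - 1 / L)) - L / Real.log 2 / (1 + a) =
      (1 - (1 + l) * (1 + a)) / (Real.log 2 * ((a + 1 - 1 / L) * (1 + a))) := by
    have h1a : (1 + a) ≠ 0 := by linarith
    rw [div_div, div_sub_div _ _ (by positivity) (by positivity),
      div_eq_div_iff (by positivity) (by positivity)]
    have hLL : L * (1 / L) = 1 := by field_simp
    generalize 1 / L = e at *
    linear_combination (Real.log 2) ^ 2 * (1 + a) * (a + 1 - e) * hLL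
  rw [hid, abs_div, abs_of_pos (by positivity : 0 < Real.log 2 * ((a + 1 - 1 / L) * (1 + a))),
    div_le_div_iff₀ (by positivity) (by positivity)]
  have hnum : |1 - (1 + l) * (1 + a)| ≤ 2 * (1 + a) := by
    rw [abs_le]
    constructor <;> nlinarith
  calc |1 - (1 + l) * (1 + a)| * (a * Real.log 2)
      ≤ 2 * (1 + a) * ((a + 1 - 1 / L) * Real.log 2) := by gcongr
    _ = 2 * (Real.log 2 * ((a + 1 - 1 / L) * (1 + a))) := by ring

theorem one_le_depth {d : ℕ} [NeZero d] (n : ℕ) : 1 ≤ depth d n := by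
  unfold depth
  split_ifs with h
  · exact le_rfl
  · exact Nat.one_le_ceil_iff.2 (depthReal_pos (not_lt.1 h))

theorem depth_cast_eq_ceil {d n : ℕ} [NeZero d] (hn : 3 ≤ n) :
    (depth d n : ℤ) = ⌈depthReal d n⌉ := by
  rw [depth, if_neg (not_lt.2 hn), Int.natCast_ceil_eq_ceil (depthReal_pos hn).le]

theorem depth_ge {d n : ℕ} [NeZero d] (hn : 3 ≤ n) :
    Real.logb 2 n / (1 + biasExponent d) - 2 / (biasExponent d * Real.log 2) ≤ depth d n := by
  have h := (abs_le.1 (abs_depthReal_sub_le (d := d) hn)).1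
  rw [depth, if_neg (not_lt.2 hn)]
  linarith [Nat.le_ceil (depthReal d n)]

theorem depth_le {d n : ℕ} [NeZero d] (hn : 3 ≤ n) :
    (depth d n : ℝ) ≤
      Real.logb 2 n / (1 + biasExponent d) + (2 / (biasExponent d * Real.log 2) + 1) := by
  have h := (abs_le.1 (abs_depthReal_sub_le (d := d) hn)).2
  rw [depth, if_neg (not_lt.2 hn)]
  linarith [Nat.ceil_lt_add_one (depthReal_pos (d := d) hn).le]

theorem tendsto_depth (d : ℕ) [NeZero d] : Tendsto (depth d) atTop atTop := by
  have ha := biasExponent_pos (d := d)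
  rw [← tendsto_natCast_atTop_iff (R := ℝ)]
  have h : Tendsto (fun n : ℕ => Real.logb 2 n / (1 + biasExponent d) -
      2 / (biasExponent d * Real.log 2)) atTop atTop :=
    tendsto_atTop_add_const_right _ _ (((Real.tendsto_logb_atTop one_lt_two).comp
      tendsto_natCast_atTop_atTop).atTop_div_const (by linarith))
  refine tendsto_atTop_mono' _ ?_ h
  filter_upwards [eventually_ge_atTop 3] with n hn using depth_ge hn

/-- With the chosen depth the variance term `2 ^ k / n` and the squared bias term
`(1 - 1 / (2 d)) ^ (2 k)` are both of order `n ^ (-a / (1 + a))`, `a = biasExponent d`, and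
`a ≥ 1 / (d log 2)`. -/
theorem exists_variance_add_bias_le (d : ℕ) [NeZero d] : ∃ C : ℝ, 0 ≤ C ∧ ∀ n : ℕ, 1 < n →
    (2 : ℝ) ^ depth d n / n + (1 - 1 / (2 * (d : ℝ))) ^ (2 * depth d n) ≤
      C * (n : ℝ) ^ (-(1 / (1 + (d : ℝ) * Real.log 2))) := by
  have ha := biasExponent_pos (d := d)
  have had := one_le_biasExponent_mul (d := d)
  have hd : (1 : ℝ) ≤ d := Nat.one_le_cast.2 (NeZero.pos d)
  have h2 : 0 < Real.log 2 := Real.log_pos one_lt_two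
  set a := biasExponent d with hadef
  set B := 2 / (a * Real.log 2)
  set γ := 1 / (1 + (d : ℝ) * Real.log 2) with hγ
  have hγ1 : γ ≤ 1 := by
    rw [hγ, div_le_one (by positivity)]
    have : 0 ≤ (d : ℝ) * Real.log 2 := by positivity
    linarith
  have hγa : γ ≤ a / (1 + a) := by
    rw [hγ, div_le_div_iff₀ (by positivity) (by positivity)]
    linarith
  refine ⟨4 + 2 ^ (B + 1) + 2 ^ (a * B), by positivity, fun n hn => ?_⟩
  have hn0 : (0 : ℝ) < n := by positivity
  have hn1 : (1 : ℝ) ≤ n := by exact_mod_cast hn.le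
  rcases Nat.lt_or_ge n 3 with h3 | h3
  · obtain rfl : n = 2 := by omega
    have hr1 : (1 - 1 / (2 * (d : ℝ))) ^ (2 * depth d 2) ≤ 1 := by
      refine pow_le_one₀ ((by norm_num : (0 : ℝ) ≤ 1 / 2).trans half_le_shrink) ?_
      have : 0 ≤ 1 / (2 * (d : ℝ)) := by positivity
      linarith
    -- For `n = 2` the left side is at most `2`, and `n ^ (-γ) ≥ 1 / 2` because `γ ≤ 1`.
    have hk : depth d 2 = 1 := by simp [depth]
    have hlow : (1 : ℝ) / 2 ≤ ((2 : ℕ) : ℝ) ^ (-γ) := by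
      have : (2 : ℝ) ^ (-1 : ℝ) ≤ (2 : ℝ) ^ (-γ) :=
        Real.rpow_le_rpow_of_exponent_le one_le_two (by linarith)
      rw [Real.rpow_neg_one] at this
      push_cast
      linarith
    calc (2 : ℝ) ^ depth d 2 / (2 : ℕ) + (1 - 1 / (2 * (d : ℝ))) ^ (2 * depth d 2)
        ≤ 1 + 1 := add_le_add (by rw [hk]; norm_num) hr1
      _ = 4 * (1 / 2) := by norm_num
      _ ≤ (4 + 2 ^ (B + 1) + 2 ^ (a * B)) * ((2 : ℕ) : ℝ) ^ (-γ) := by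
        have h4 : (0 : ℝ) ≤ 2 ^ (B + 1) + 2 ^ (a * B) := by positivity
        exact mul_le_mul (by linarith) hlow (by norm_num) (by linarith)
  · have hpow : ∀ s : ℝ, (2 : ℝ) ^ (Real.logb 2 n * s) = (n : ℝ) ^ s := fun s => by
      rw [Real.rpow_mul zero_le_two, Real.rpow_logb zero_lt_two (by norm_num) hn0]
    have hmono : (n : ℝ) ^ (-(a / (1 + a))) ≤ (n : ℝ) ^ (-γ) :=
      Real.rpow_le_rpow_of_exponent_le hn1 (by linarith)
    have hvar : (2 : ℝ) ^ depth d n / n ≤ 2 ^ (B + 1) * (n : ℝ) ^ (-γ) := by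
      have h1 : (2 : ℝ) ^ depth d n ≤ (n : ℝ) ^ (1 / (1 + a)) * 2 ^ (B + 1) := by
        rw [← hpow, ← Real.rpow_add zero_lt_two, ← Real.rpow_natCast]
        refine Real.rpow_le_rpow_of_exponent_le one_le_two ?_
        rw [mul_one_div]
        exact depth_le h3
      have h4 : (n : ℝ) ^ (1 / (1 + a)) / n = (n : ℝ) ^ (-(a / (1 + a))) := by
        rw [← Real.rpow_sub_one hn0.ne']
        congr 1
        field_simp
        ring
      calc (2 : ℝ) ^ depth d n / n ≤ (n : ℝ) ^ (1 / (1 + a)) * 2 ^ (B + 1) / n := by gcongr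
        _ = 2 ^ (B + 1) * (n : ℝ) ^ (-(a / (1 + a))) := by rw [← h4]; ring
        _ ≤ _ := by gcongr
    have hbias : (1 - 1 / (2 * (d : ℝ))) ^ (2 * depth d n) ≤ 2 ^ (a * B) * (n : ℝ) ^ (-γ) := by
      calc (1 - 1 / (2 * (d : ℝ))) ^ (2 * depth d n) = (2 : ℝ) ^ (-a * depth d n) :=
            shrink_sq_pow _
        _ ≤ (2 : ℝ) ^ (a * B + Real.logb 2 n * (-(a / (1 + a)))) := by
            refine Real.rpow_le_rpow_of_exponent_le one_le_two ?_
            have h5 := mul_le_mul_of_nonneg_left (depth_ge (d := d) h3) ha.le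
            have h6 : Real.logb 2 n * (-(a / (1 + a))) = -(a * (Real.logb 2 n / (1 + a))) := by
              ring
            rw [h6]
            linarith
        _ = 2 ^ (a * B) * (n : ℝ) ^ (-(a / (1 + a))) := by
            rw [Real.rpow_add zero_lt_two, hpow]
        _ ≤ _ := by gcongr
    have h7 : 0 ≤ (n : ℝ) ^ (-γ) := by positivity
    linarith

/-! ### Risk of weighted averages of noisy observations -/

section WeightedAverage

variable {Ω E : Type*} [MeasurableSpace Ω] [MeasurableSpace E] {P : Measure Ω}
  [IsProbabilityMeasure P] {μ : Measure E} {n : ℕ}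

theorem integrable_of_bounded {f : Ω → ℝ} (hf : Measurable f) {B : ℝ} (hB : ∀ ω, |f ω| ≤ B) :
    Integrable f P :=
  Integrable.of_bound hf.aestronglyMeasurable B (ae_of_all _ hB)

/-- The sum of a bounded function over an i.i.d. sample: its mean square deviation from the mean
is at most `n` times the second moment. -/
theorem integral_sum_sub_sq_le {X : Fin n → Ω → E} (hX : ∀ i, Measurable (X i))
    (hlaw : ∀ i, P.map (X i) = μ) (hind : iIndepFun X P) {f : E → ℝ} (hf : Measurable f) {B : ℝ}
    (hB : ∀ z, |f z| ≤ B) :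
    ∫ ω, (∑ i, f (X i ω) - n * ∫ z, f z ∂μ) ^ 2 ∂P ≤ n * ∫ z, f z ^ 2 ∂μ := by
  have hm : ∀ i, Measurable fun ω => f (X i ω) := fun i => hf.comp (hX i)
  have hLp : ∀ i, MemLp (fun ω => f (X i ω)) 2 P := fun i =>
    MemLp.of_bound (hm i).aestronglyMeasurable B (ae_of_all _ fun ω => hB _)
  have hmean : ∫ ω, (∑ i, f (X i ω)) ∂P = n * ∫ z, f z ∂μ := by
    rw [integral_finsetSum _ fun i _ => (hLp i).integrable one_le_two]
    have : ∀ i, ∫ ω, f (X i ω) ∂P = ∫ z, f z ∂μ := fun i => by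
      rw [← hlaw i, integral_map (hX i).aemeasurable hf.aestronglyMeasurable]
    simp [this]
  have hvar : Var[∑ i, fun ω => f (X i ω); P] = ∑ i, Var[fun ω => f (X i ω); P] :=
    IndepFun.variance_sum (fun i _ => hLp i) fun i _ j _ hij =>
      (hind.indepFun hij).comp hf hf
  have hsum : (∑ i, fun ω => f (X i ω)) = fun ω => ∑ i, f (X i ω) := by
    ext ω
    simp
  have hL : ∫ ω, (∑ i, f (X i ω) - n * ∫ z, f z ∂μ) ^ 2 ∂P =
      Var[∑ i, fun ω => f (X i ω); P] := by
    rw [hsum, variance_eq_integral (Finset.measurable_sum _ fun i _ => hm i).aemeasurable, hmean]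
  rw [hL, hvar]
  calc ∑ i, Var[fun ω => f (X i ω); P] ≤ ∑ _i : Fin n, ∫ z, f z ^ 2 ∂μ := by
        refine Finset.sum_le_sum fun i _ => ?_
        refine (variance_le_expectation_sq (hm i).aestronglyMeasurable).trans_eq ?_
        rw [← hlaw i, integral_map (hX i).aemeasurable (hf.pow_const 2).aestronglyMeasurable]
        rfl
    _ = n * ∫ z, f z ^ 2 ∂μ := by simp

theorem integral_sum_sq_le {X : Fin n → Ω → E} (hX : ∀ i, Measurable (X i))
    (hlaw : ∀ i, P.map (X i) = μ) (hind : iIndepFun X P) {f : E → ℝ} (hf : Measurable f) {B : ℝ}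
    (hB : ∀ z, |f z| ≤ B) :
    ∫ ω, (∑ i, f (X i ω)) ^ 2 ∂P ≤
      2 * (n * ∫ z, f z ^ 2 ∂μ) + 2 * (n * ∫ z, f z ∂μ) ^ 2 := by
  have h := integral_sum_sub_sq_le hX hlaw hind hf hB
  set M := n * ∫ z, f z ∂μ
  have hm : Measurable fun ω => ∑ i, f (X i ω) :=
    Finset.measurable_sum _ fun i _ => hf.comp (hX i)
  have hb : ∀ ω, |∑ i, f (X i ω)| ≤ n * B := fun ω =>
    (Finset.abs_sum_le_sum_abs _ _).trans
      ((Finset.sum_le_sum fun i _ => hB (X i ω)).trans_eq (by simp))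
  have hi1 : Integrable (fun ω => (∑ i, f (X i ω) - M) ^ 2) P := by
    refine integrable_of_bounded ((hm.sub_const M).pow_const 2) (B := (n * B + |M|) ^ 2)
      fun ω => ?_
    rw [abs_pow]
    exact pow_le_pow_left₀ (abs_nonneg _)
      ((abs_sub _ _).trans (add_le_add (hb ω) le_rfl)) 2
  have hi2 : Integrable (fun ω => (∑ i, f (X i ω)) ^ 2) P := by
    refine integrable_of_bounded (hm.pow_const 2) (B := (n * B) ^ 2) fun ω => ?_
    rw [abs_pow]
    exact pow_le_pow_left₀ (abs_nonneg _) (hb ω) 2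
  calc ∫ ω, (∑ i, f (X i ω)) ^ 2 ∂P
      ≤ ∫ ω, (2 * (∑ i, f (X i ω) - M) ^ 2 + 2 * M ^ 2) ∂P := by
        refine integral_mono hi2 ((hi1.const_mul 2).add (integrable_const _)) fun ω => ?_
        nlinarith [sq_nonneg (∑ i, f (X i ω) - M - M)]
    _ = 2 * ∫ ω, (∑ i, f (X i ω) - M) ^ 2 ∂P + 2 * M ^ 2 := by
        rw [integral_add (hi1.const_mul 2) (integrable_const _), integral_const_mul]
        simp
    _ ≤ _ := by linarith

/-- If the pairs `(X i, ε i)` are independent and `X i`, `ε i` are independent for every `i`, then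
the whole design is independent of the whole noise. -/
theorem indepFun_design_noise {X : Fin n → Ω → E} {ε : Fin n → Ω → ℝ}
    (hX : ∀ i, Measurable (X i)) (hε : ∀ i, Measurable (ε i)) (hXε : ∀ i, X i ⟂ᵢ[P] ε i)
    (hind : iIndepFun (fun i ω => (X i ω, ε i ω)) P) :
    (fun ω i => X i ω) ⟂ᵢ[P] (fun ω i => ε i ω) := by
  have hXp : iIndepFun X P := hind.comp (fun _ => Prod.fst) fun _ => measurable_fst
  have hεp : iIndepFun ε P := hind.comp (fun _ => Prod.snd) fun _ => measurable_snd
  have : ∀ i, IsProbabilityMeasure (P.map (X i)) := fun i =>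
    Measure.isProbabilityMeasure_map (hX i).aemeasurable
  have : ∀ i, IsProbabilityMeasure (P.map (ε i)) := fun i =>
    Measure.isProbabilityMeasure_map (hε i).aemeasurable
  have h1 := (iIndepFun_iff_map_fun_eq_pi_map
    fun i => ((hX i).prodMk (hε i)).aemeasurable).1 hind
  have h2 : ∀ i, P.map (fun ω => (X i ω, ε i ω)) = (P.map (X i)).prod (P.map (ε i)) := fun i =>
    (indepFun_iff_map_prod_eq_prod_map_map (hX i).aemeasurable (hε i).aemeasurable).1 (hXε i)
  simp_rw [h2] at h1
  have h3 := (measurePreserving_arrowProdEquivProdArrow E ℝ (Fin n)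
    (fun i => P.map (X i)) fun i => P.map (ε i)).map_eq
  rw [← h1, Measure.map_map (MeasurableEquiv.measurable _)
    (measurable_pi_lambda _ fun i => (hX i).prodMk (hε i)),
    ← (iIndepFun_iff_map_fun_eq_pi_map fun i => (hX i).aemeasurable).1 hXp,
    ← (iIndepFun_iff_map_fun_eq_pi_map fun i => (hε i).aemeasurable).1 hεp] at h3
  exact (indepFun_iff_map_prod_eq_prod_map_map (measurable_pi_lambda _ hX).aemeasurable
    (measurable_pi_lambda _ hε).aemeasurable).2 h3

/-- Averaging centered independent noise with coefficients that depend on an independent random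
element `Z`: the mean square is the noise variance times the expected sum of squared
coefficients. -/
theorem integral_sum_mul_noise_sq {F : Type*} [MeasurableSpace F] {Z : Ω → F} (hZ : Measurable Z)
    {ε : Fin n → Ω → ℝ} {v : ℝ≥0} (hε : ∀ i, Measurable (ε i))
    (hlaw : ∀ i, P.map (ε i) = gaussianReal 0 v) (hind : iIndepFun ε P)
    (hZε : Z ⟂ᵢ[P] (fun ω i => ε i ω)) {a : Fin n → F → ℝ} (ha : ∀ i, Measurable (a i))
    (ha1 : ∀ i z, |a i z| ≤ 1) :
    Integrable (fun ω => (∑ i, a i (Z ω) * ε i ω) ^ 2) P ∧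
      ∫ ω, (∑ i, a i (Z ω) * ε i ω) ^ 2 ∂P = v * ∫ ω, ∑ i, a i (Z ω) ^ 2 ∂P := by
  have hLp : ∀ i, MemLp (ε i) 2 P := fun i => by
    have h := memLp_id_gaussianReal (μ := 0) (v := v) 2
    rw [← hlaw i] at h
    exact h.comp_of_map (hε i).aemeasurable
  have hmean : ∀ i, ∫ ω, ε i ω ∂P = 0 := fun i => by
    have h : ∫ x, x ∂(gaussianReal 0 v) = 0 := integral_id_gaussianReal
    rw [← hlaw i, integral_map (hε i).aemeasurable (by fun_prop)] at h
    exact h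
  have hsq : ∀ i, ∫ ω, ε i ω * ε i ω ∂P = v := fun i => by
    have h := variance_fun_id_gaussianReal (μ := 0) (v := v)
    rw [variance_eq_integral (by fun_prop), integral_id_gaussianReal, ← hlaw i,
      integral_map (hε i).aemeasurable (by fun_prop)] at h
    rw [← h]
    refine integral_congr_ae (ae_of_all _ fun ω => ?_)
    simp only [sub_zero]
    ring
  have hεε : ∀ i j, ∫ ω, ε i ω * ε j ω ∂P = if i = j then (v : ℝ) else 0 := fun i j => by
    split_ifs with hij
    · rw [← hij, hsq]
    · rw [(hind.indepFun hij).integral_fun_mul_eq_mul_integral (hε i).aestronglyMeasurable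
        (hε j).aestronglyMeasurable, hmean, zero_mul]
  have hpi : ∀ i j, Integrable (fun ω => ε i ω * ε j ω) P := fun i j =>
    (hLp i).integrable_mul (hLp j)
  have haZ : ∀ i, Measurable fun ω => a i (Z ω) := fun i => (ha i).comp hZ
  have hai : ∀ i j, Integrable (fun ω => (a i (Z ω) * a j (Z ω)) * (ε i ω * ε j ω)) P :=
    fun i j => (hpi i j).bdd_mul ((haZ i).mul (haZ j)).aestronglyMeasurable (c := 1)
      (ae_of_all _ fun ω => by
        rw [Real.norm_eq_abs, abs_mul]
        exact mul_le_one₀ (ha1 i _) (abs_nonneg _) (ha1 j _))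
  have hterm : ∀ i j, ∫ ω, (a i (Z ω) * a j (Z ω)) * (ε i ω * ε j ω) ∂P =
      if i = j then v * ∫ ω, a i (Z ω) ^ 2 ∂P else 0 := fun i j => by
    have h := hZε.integral_fun_comp_mul_comp (f := fun z => a i z * a j z)
      (g := fun e : Fin n → ℝ => e i * e j) hZ.aemeasurable
      (measurable_pi_lambda _ hε).aemeasurable
      ((ha i).mul (ha j)).aestronglyMeasurable
      ((measurable_pi_apply i).mul (measurable_pi_apply j)).aestronglyMeasurable
    rw [h, hεε]
    split_ifs with hij
    · subst hij
      rw [mul_comm]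
      simp_rw [sq]
    · rw [mul_zero]
  have hexp : (fun ω => (∑ i, a i (Z ω) * ε i ω) ^ 2) =
      fun ω => ∑ i, ∑ j, (a i (Z ω) * a j (Z ω)) * (ε i ω * ε j ω) := by
    ext ω
    rw [sq, Finset.sum_mul_sum]
    exact Finset.sum_congr rfl fun i _ => Finset.sum_congr rfl fun j _ => by ring
  have hint : ∀ i, Integrable (fun ω => a i (Z ω) ^ 2) P := fun i =>
    integrable_of_bounded ((haZ i).pow_const 2) (B := 1) fun ω => by
      rw [abs_pow]
      exact pow_le_one₀ (abs_nonneg _) (ha1 i _)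
  rw [hexp]
  refine ⟨integrable_finsetSum _ fun i _ => integrable_finsetSum _ fun j _ => hai i j, ?_⟩
  rw [integral_finsetSum _ fun i _ => integrable_finsetSum _ fun j _ => hai i j,
    integral_finsetSum _ fun i _ => hint i, Finset.mul_sum]
  refine Finset.sum_congr rfl fun i _ => ?_
  rw [integral_finsetSum _ fun j _ => hai i j]
  simp_rw [hterm]
  simp

/-- The normalised weight `w i / ∑ j, w j` is at most `1` in absolute value (also when the total
weight vanishes, the quotient then being `0`). -/
theorem abs_div_sum_le_one {w : Fin n → ℝ} (hw : ∀ i, 0 ≤ w i) (i : Fin n) :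
    |w i / ∑ j, w j| ≤ 1 := by
  have h0 : 0 ≤ ∑ j, w j := Finset.sum_nonneg fun j _ => hw j
  rw [abs_of_nonneg (div_nonneg (hw i) h0)]
  exact div_le_one_of_le₀ (Finset.single_le_sum (fun j _ => hw j) (Finset.mem_univ i)) h0

/-- Control of a weighted average of `D i ∈ [0, B]` without any lower bound on the total weight:
when the total weight is below half of `s`, its deviation from `s` is at least `s / 2`, and the
weighted average is still at most `B`. -/
theorem weighted_average_sq_le {w D : Fin n → ℝ} (hw : ∀ i, 0 ≤ w i) (hD : ∀ i, 0 ≤ D i) {B : ℝ}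
    (hB : ∀ i, D i ≤ B) {s : ℝ} (hs : 0 < s) :
    ((∑ i, w i * D i) / ∑ i, w i) ^ 2 ≤
      4 / s ^ 2 * (∑ i, w i * D i) ^ 2 + 4 * B ^ 2 / s ^ 2 * (∑ i, w i - s) ^ 2 := by
  have hU : 0 ≤ ∑ i, w i := Finset.sum_nonneg fun j _ => hw j
  have hV : 0 ≤ ∑ i, w i * D i := Finset.sum_nonneg fun j _ => mul_nonneg (hw j) (hD j)
  have hVU : ∑ i, w i * D i ≤ (∑ i, w i) * B := by
    rw [Finset.sum_mul]
    exact Finset.sum_le_sum fun i _ => mul_le_mul_of_nonneg_left (hB i) (hw i)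
  set U := ∑ i, w i
  set V := ∑ i, w i * D i
  rcases le_or_gt (s / 2) U with h | h
  · have h1 : V / U ≤ V / (s / 2) := div_le_div_of_nonneg_left hV (by linarith) h
    calc (V / U) ^ 2 ≤ (V / (s / 2)) ^ 2 := pow_le_pow_left₀ (div_nonneg hV hU) h1 2
      _ = 4 / s ^ 2 * V ^ 2 := by field_simp; ring
      _ ≤ _ := le_add_of_nonneg_right (by positivity)
  · rcases hU.eq_or_lt with h0 | h0
    · rw [← h0, div_zero, zero_pow two_ne_zero]
      positivity
    · have h1 : V / U ≤ B := by
        rw [div_le_iff₀ h0]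
        linarith
      have h2 : (s / 2) ^ 2 ≤ (U - s) ^ 2 := by nlinarith
      calc (V / U) ^ 2 ≤ B ^ 2 := pow_le_pow_left₀ (div_nonneg hV hU) h1 2
        _ = 4 * B ^ 2 / s ^ 2 * (s / 2) ^ 2 := by field_simp; norm_num
        _ ≤ 4 * B ^ 2 / s ^ 2 * (U - s) ^ 2 := by gcongr
        _ ≤ _ := le_add_of_nonneg_left (by positivity)

theorem sum_sq_weights_le {w : Fin n → ℝ} (hw : ∀ i, 0 ≤ w i) (hw1 : ∀ i, w i ≤ 1) {s : ℝ}
    (hs : 0 < s) :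
    ∑ i, (w i / ∑ j, w j) ^ 2 ≤ 2 / s + 4 / s ^ 2 * (∑ i, w i - s) ^ 2 := by
  have hU : 0 ≤ ∑ i, w i := Finset.sum_nonneg fun j _ => hw j
  have hle : ∀ c, (∀ i, w i ≤ c) → ∑ i, (w i / ∑ j, w j) ^ 2 ≤ c * (∑ i, w i) / (∑ i, w i) ^ 2 :=
    fun c hc => by
      rw [Finset.mul_sum, Finset.sum_div]
      refine Finset.sum_le_sum fun i _ => ?_
      rw [div_pow, sq (w i)]
      gcongr
      · exact hw i
      · exact hc i
  have h1 := hle 1 hw1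
  have h2 := hle _ fun i => Finset.single_le_sum (fun j _ => hw j) (Finset.mem_univ i)
  set U := ∑ i, w i
  rcases le_or_gt (s / 2) U with h | h
  · have hU0 : 0 < U := by linarith
    calc _ ≤ 1 * U / U ^ 2 := h1
      _ = 1 / U := by field_simp
      _ ≤ 1 / (s / 2) := one_div_le_one_div_of_le (by linarith) h
      _ = 2 / s := by field_simp
      _ ≤ _ := le_add_of_nonneg_right (by positivity)
  · have h3 : (s / 2) ^ 2 ≤ (U - s) ^ 2 := by nlinarith
    calc _ ≤ U * U / U ^ 2 := h2
      _ ≤ 1 := by rw [← sq]; exact div_self_le_one _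
      _ = 4 / s ^ 2 * (s / 2) ^ 2 := by field_simp; norm_num
      _ ≤ 4 / s ^ 2 * (U - s) ^ 2 := by gcongr
      _ ≤ _ := le_add_of_nonneg_left (by positivity)

/-- Pointwise bound for the squared error of the weighted average of the observations `g i + e i`
as an estimate of `y`, into bias, noise and the event of vanishing total weight. -/
theorem weighted_average_error_sq_le {w g e D : Fin n → ℝ} {y : ℝ} (hw : ∀ i, 0 ≤ w i)
    (hD : ∀ i, |g i - y| ≤ D i) {B : ℝ} (hB : ∀ i, D i ≤ B) {s : ℝ} (hs : 0 < s) :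
    ((∑ i, w i * (g i + e i)) / ∑ i, w i - y) ^ 2 ≤
      3 * (4 / s ^ 2 * (∑ i, w i * D i) ^ 2 + 4 * B ^ 2 / s ^ 2 * (∑ i, w i - s) ^ 2) +
        3 * (∑ i, (w i / ∑ j, w j) * e i) ^ 2 + 3 * (y ^ 2 / s ^ 2 * (∑ i, w i - s) ^ 2) := by
  have hD0 : ∀ i, 0 ≤ D i := fun i => (abs_nonneg _).trans (hD i)
  have hbias := weighted_average_sq_le hw hD0 hB hs
  have hU : 0 ≤ ∑ i, w i := Finset.sum_nonneg fun j _ => hw j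
  have hV : |∑ i, w i * (g i - y)| ≤ ∑ i, w i * D i :=
    (Finset.abs_sum_le_sum_abs _ _).trans (Finset.sum_le_sum fun i _ => by
      rw [abs_mul, abs_of_nonneg (hw i)]
      exact mul_le_mul_of_nonneg_left (hD i) (hw i))
  have hR : ((∑ i, w i * (g i - y)) / ∑ i, w i) ^ 2 ≤ ((∑ i, w i * D i) / ∑ i, w i) ^ 2 := by
    rw [div_pow, div_pow, ← sq_abs (∑ i, w i * (g i - y))]
    gcongr
  have hN : ∑ i, (w i / ∑ j, w j) * e i = (∑ i, w i * e i) / ∑ i, w i := by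
    rw [Finset.sum_div]
    exact Finset.sum_congr rfl fun i _ => by ring
  have hsplit : ∑ i, w i * (g i + e i) =
      ∑ i, w i * (g i - y) + ∑ i, w i * e i + (∑ i, w i) * y := by
    rw [Finset.sum_mul, ← Finset.sum_add_distrib, ← Finset.sum_add_distrib]
    exact Finset.sum_congr rfl fun i _ => by ring
  rw [hN, hsplit]
  set U := ∑ i, w i
  have h0 : 0 ≤ y ^ 2 / s ^ 2 * (U - s) ^ 2 := by positivity
  rcases hU.eq_or_lt with h | h
  · -- The quotients vanish, the error is `y ^ 2`, and `(U - s) ^ 2 = s ^ 2`.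
    rw [← h] at hbias ⊢
    have h1 : y ^ 2 / s ^ 2 * (0 - s) ^ 2 = y ^ 2 := by field_simp; ring
    rw [h1]
    simp only [div_zero] at hbias ⊢
    nlinarith [sq_nonneg y]
  · have h1 : (∑ i, w i * (g i - y) + ∑ i, w i * e i + U * y) / U - y =
        (∑ i, w i * (g i - y)) / U + (∑ i, w i * e i) / U := by
      field_simp
      ring
    rw [h1]
    nlinarith [sq_nonneg ((∑ i, w i * (g i - y)) / U - (∑ i, w i * e i) / U),
      sq_nonneg ((∑ i, w i * e i) / U), sq_nonneg ((∑ i, w i * (g i - y)) / U)]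

/-- Risk of the weighted average of noisy observations of `g`, the weights being `w (X i)` for a
fixed function `w` with values in `[0, 1]`: the variance and the effect of a vanishing total weight
are of order `1 / (n p)` with `p = ∫ w`, and the bias is the `w`-average of the bound `D` of
`|g - y|`. -/
theorem weighted_average_risk_le [IsProbabilityMeasure μ] {X : Fin n → Ω → E} {ε : Fin n → Ω → ℝ} {v : ℝ≥0}
    (hX : ∀ i, Measurable (X i)) (hε : ∀ i, Measurable (ε i))
    (hXlaw : ∀ i, P.map (X i) = μ) (hεlaw : ∀ i, P.map (ε i) = gaussianReal 0 v)
    (hXε : ∀ i, X i ⟂ᵢ[P] ε i) (hind : iIndepFun (fun i ω => (X i ω, ε i ω)) P) (hn : 0 < n)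
    {w g D : E → ℝ} (hwm : Measurable w) (hgm : Measurable g) (hDm : Measurable D)
    (hw : ∀ z, 0 ≤ w z) (hw1 : ∀ z, w z ≤ 1) {y : ℝ} (hD : ∀ z, |g z - y| ≤ D z) {B : ℝ}
    (hB : ∀ z, D z ≤ B) (hp : 0 < ∫ z, w z ∂μ) :
    Integrable (fun ω =>
      ((∑ i, w (X i ω) * (g (X i ω) + ε i ω)) / ∑ i, w (X i ω) - y) ^ 2) P ∧
    ∫ ω, ((∑ i, w (X i ω) * (g (X i ω) + ε i ω)) / ∑ i, w (X i ω) - y) ^ 2 ∂P ≤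
      (36 * B ^ 2 + 18 * v + 3 * y ^ 2) / (n * ∫ z, w z ∂μ) +
        24 * ((∫ z, w z * D z ∂μ) / ∫ z, w z ∂μ) ^ 2 := by
  have hD0 : ∀ z, 0 ≤ D z := fun z => (abs_nonneg _).trans (hD z)
  have hw1' : ∀ z, |w z| ≤ 1 := fun z => by rw [abs_of_nonneg (hw z)]; exact hw1 z
  have hwD : ∀ z, |w z * D z| ≤ B := fun z => by
    rw [abs_of_nonneg (mul_nonneg (hw z) (hD0 z))]
    exact (mul_le_of_le_one_left (hD0 z) (hw1 z)).trans (hB z)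
  have hXp : iIndepFun X P := hind.comp (fun _ => Prod.fst) fun _ => measurable_fst
  have hεp : iIndepFun ε P := hind.comp (fun _ => Prod.snd) fun _ => measurable_snd
  set p := ∫ z, w z ∂μ with hpdef
  set β := ∫ z, w z * D z ∂μ
  have hn0 : (0 : ℝ) < n := Nat.cast_pos.2 hn
  have hs : 0 < n * p := mul_pos hn0 hp
  have hwint : Integrable w μ := integrable_of_bounded hwm hw1'
  have hUs : ∫ ω, (∑ i, w (X i ω) - n * p) ^ 2 ∂P ≤ n * p := by
    refine (integral_sum_sub_sq_le hX hXlaw hXp hwm hw1').trans ?_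
    refine mul_le_mul_of_nonneg_left (integral_mono ?_ hwint fun z => ?_) hn0.le
    · refine integrable_of_bounded (hwm.pow_const 2) (B := 1) fun z => ?_
      rw [abs_pow]
      exact pow_le_one₀ (abs_nonneg _) (hw1' z)
    · exact pow_le_of_le_one (hw z) (hw1 z) two_ne_zero
  have hV : ∫ ω, (∑ i, w (X i ω) * D (X i ω)) ^ 2 ∂P ≤
      2 * (n * (B ^ 2 * p)) + 2 * (n * β) ^ 2 := by
    refine (integral_sum_sq_le hX hXlaw hXp (f := fun z => w z * D z) (hwm.mul hDm) hwD).trans ?_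
    refine add_le_add_left (mul_le_mul_of_nonneg_left
      (mul_le_mul_of_nonneg_left ?_ hn0.le) zero_le_two) _
    rw [← integral_const_mul]
    refine integral_mono ?_ (hwint.const_mul _) fun z => ?_
    · refine integrable_of_bounded ((hwm.mul hDm).pow_const 2) (B := B ^ 2) fun z => ?_
      rw [abs_pow]
      exact pow_le_pow_left₀ (abs_nonneg _) (hwD z) 2
    · change (w z * D z) ^ 2 ≤ B ^ 2 * w z
      rw [mul_pow, mul_comm]
      exact mul_le_mul (pow_le_pow_left₀ (hD0 z) (hB z) 2)
        (pow_le_of_le_one (hw z) (hw1 z) two_ne_zero) (by positivity) (by positivity)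
  have hUm : Measurable fun ω => ∑ i, w (X i ω) :=
    Finset.measurable_sum _ fun i _ => hwm.comp (hX i)
  have hVm : Measurable fun ω => ∑ i, w (X i ω) * D (X i ω) :=
    Finset.measurable_sum _ fun i _ => (hwm.mul hDm).comp (hX i)
  have hUi : Integrable (fun ω => (∑ i, w (X i ω) - n * p) ^ 2) P := by
    refine integrable_of_bounded ((hUm.sub_const _).pow_const 2) (B := (n * 1 + |n * p|) ^ 2)
      fun ω => ?_
    rw [abs_pow]
    refine pow_le_pow_left₀ (abs_nonneg _) ((abs_sub _ _).trans (add_le_add ?_ le_rfl)) 2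
    exact (Finset.abs_sum_le_sum_abs _ _).trans
      ((Finset.sum_le_sum fun i _ => hw1' (X i ω)).trans_eq (by simp))
  have hVi : Integrable (fun ω => (∑ i, w (X i ω) * D (X i ω)) ^ 2) P := by
    refine integrable_of_bounded (hVm.pow_const 2) (B := (n * B) ^ 2) fun ω => ?_
    rw [abs_pow]
    refine pow_le_pow_left₀ (abs_nonneg _) ?_ 2
    exact (Finset.abs_sum_le_sum_abs _ _).trans
      ((Finset.sum_le_sum fun i _ => hwD (X i ω)).trans_eq (by simp))
  have ham : ∀ i : Fin n, Measurable fun z : Fin n → E => w (z i) / ∑ j, w (z j) := fun i =>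
    (hwm.comp (measurable_pi_apply i)).div
      (Finset.measurable_sum _ fun j _ => hwm.comp (measurable_pi_apply j))
  have ha1 : ∀ (i : Fin n) (z : Fin n → E), |w (z i) / ∑ j, w (z j)| ≤ 1 := fun i z =>
    abs_div_sum_le_one (fun j => hw (z j)) i
  obtain ⟨hNi, hNeq⟩ := integral_sum_mul_noise_sq (measurable_pi_lambda _ hX) hε hεlaw hεp
    (indepFun_design_noise hX hε hXε hind) ham ha1
  have hN : ∫ ω, (∑ i, (w (X i ω) / ∑ j, w (X j ω)) * ε i ω) ^ 2 ∂P ≤ v * (6 / (n * p)) := by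
    rw [hNeq]
    refine mul_le_mul_of_nonneg_left ?_ v.2
    calc ∫ ω, ∑ i, (w (X i ω) / ∑ j, w (X j ω)) ^ 2 ∂P
        ≤ ∫ ω, (2 / (n * p) + 4 / (n * p) ^ 2 * (∑ i, w (X i ω) - n * p) ^ 2) ∂P := by
          refine integral_mono (integrable_finsetSum _ fun i _ => ?_)
            ((integrable_const _).add (hUi.const_mul _)) fun ω =>
              sum_sq_weights_le (fun i => hw _) (fun i => hw1 _) hs
          refine integrable_of_bounded
            (((ham i).comp (measurable_pi_lambda _ hX)).pow_const 2) (B := 1) fun ω => ?_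
          rw [abs_pow]
          exact pow_le_one₀ (abs_nonneg _) (ha1 i fun j => X j ω)
      _ = 2 / (n * p) + 4 / (n * p) ^ 2 * ∫ ω, (∑ i, w (X i ω) - n * p) ^ 2 ∂P := by
          rw [integral_add (integrable_const _) (hUi.const_mul _), integral_const_mul]
          simp
      _ ≤ 2 / (n * p) + 4 / (n * p) ^ 2 * (n * p) := by gcongr
      _ = 6 / (n * p) := by field_simp; norm_num
  have hpt : ∀ ω, ((∑ i, w (X i ω) * (g (X i ω) + ε i ω)) / ∑ i, w (X i ω) - y) ^ 2 ≤
      12 / (n * p) ^ 2 * (∑ i, w (X i ω) * D (X i ω)) ^ 2 +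
        (12 * B ^ 2 + 3 * y ^ 2) / (n * p) ^ 2 * (∑ i, w (X i ω) - n * p) ^ 2 +
        3 * (∑ i, (w (X i ω) / ∑ j, w (X j ω)) * ε i ω) ^ 2 := fun ω => by
    refine (weighted_average_error_sq_le (fun i => hw (X i ω)) (fun i => hD (X i ω))
      (fun i => hB (X i ω)) hs).trans_eq ?_
    ring
  have hi1 := hVi.const_mul (12 / (n * p) ^ 2)
  have hi2 := hUi.const_mul ((12 * B ^ 2 + 3 * y ^ 2) / (n * p) ^ 2)
  have hi3 := hNi.const_mul 3
  have hmeas : Measurable fun ω =>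
      ((∑ i, w (X i ω) * (g (X i ω) + ε i ω)) / ∑ i, w (X i ω) - y) ^ 2 :=
    (((Finset.measurable_sum _ fun i _ => (hwm.comp (hX i)).mul
      ((hgm.comp (hX i)).add (hε i))).div hUm).sub_const y).pow_const 2
  have hint := ((hi1.add hi2).add hi3).mono' hmeas.aestronglyMeasurable
    (ae_of_all _ fun ω => by
      rw [Real.norm_of_nonneg (sq_nonneg _)]
      exact hpt ω)
  refine ⟨hint, (integral_mono hint ((hi1.add hi2).add hi3) hpt).trans ?_⟩
  rw [integral_add' (hi1.add hi2) hi3, integral_add' hi1 hi2, integral_const_mul,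
    integral_const_mul, integral_const_mul]
  calc _ ≤ 12 / (n * p) ^ 2 * (2 * (n * (B ^ 2 * p)) + 2 * (n * β) ^ 2) +
        (12 * B ^ 2 + 3 * y ^ 2) / (n * p) ^ 2 * (n * p) + 3 * (v * (6 / (n * p))) := by
        gcongr
    _ = _ := by
        field_simp
        ring

end WeightedAverage

/-! ### The connection function of the forest -/

/-- The connection function of the infinite centered forest: the probability that `z` lies in the
cell of `x` in a random centered tree of depth `k`. -/
noncomputable def connection {d : ℕ} [NeZero d] (k : ℕ) (x z : Fin d → ℝ) : ℝ :=
  ∑ T : CenteredTree d k, T.weight * (T.cell x).indicator (fun _ => (1 : ℝ)) z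

theorem volume_cube {d : ℕ} : volume (Set.Icc (0 : Fin d → ℝ) 1) = 1 := by
  simp [Real.volume_Icc_pi]

theorem setIntegral_cube_indicator_cell {d k : ℕ} (x : Fin d → ℝ)
    (T : CenteredTree d k) :
    ∫ z in Set.Icc 0 1, (T.cell x).indicator (fun _ => (1 : ℝ)) z = (1 / 2) ^ k := by
  rw [integral_indicator_const _ (T.measurableSet_cell x),
    measureReal_restrict_apply (T.measurableSet_cell x),
    Set.inter_eq_left.2 (show T.cell x ⊆ Set.Icc 0 1 from Set.inter_subset_left), T.volume_real_cell]
  simp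

theorem integrableOn_cube_indicator_cell {d k : ℕ} (x : Fin d → ℝ)
    (T : CenteredTree d k) :
    IntegrableOn ((T.cell x).indicator fun _ => (1 : ℝ)) (Set.Icc 0 1) := by
  have : IsFiniteMeasure (volume.restrict (Set.Icc (0 : Fin d → ℝ) 1)) :=
    ⟨by simp [volume_cube]⟩
  exact (integrable_const 1).indicator (T.measurableSet_cell x)

section Connection

variable {d : ℕ} [NeZero d] (k : ℕ) (x : Fin d → ℝ)

theorem connection_nonneg (z : Fin d → ℝ) : 0 ≤ connection k x z :=
  Finset.sum_nonneg fun T _ =>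
    mul_nonneg T.weight_pos.le (Set.indicator_nonneg (fun _ _ => zero_le_one) z)

theorem connection_le_one (z : Fin d → ℝ) : connection k x z ≤ 1 := by
  rw [← CenteredTree.sum_weight (d := d) (k := k)]
  refine Finset.sum_le_sum fun T _ => mul_le_of_le_one_right T.weight_pos.le ?_
  exact Set.indicator_le' (fun _ _ => le_rfl) (fun _ _ => zero_le_one) z

theorem measurable_connection : Measurable (connection k x) :=
  Finset.measurable_sum _ fun T _ =>
    (measurable_const.indicator (T.measurableSet_cell x)).const_mul _

theorem setIntegral_cube_connection :
    ∫ z in Set.Icc 0 1, connection k x z = (1 / 2) ^ k := by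
  unfold connection
  rw [integral_finsetSum _ fun T _ => (integrableOn_cube_indicator_cell x T).const_mul _]
  simp_rw [integral_const_mul, setIntegral_cube_indicator_cell, ← Finset.sum_mul,
    CenteredTree.sum_weight, one_mul]

/-- The average distance to `x` under the density proportional to `connection k x` is at most the
mean sum of the side lengths of the cell of `x`. -/
theorem setIntegral_cube_connection_mul_le {x : Fin d → ℝ} (hx : x ∈ Set.Icc (0 : Fin d → ℝ) 1)
    {D : (Fin d → ℝ) → ℝ} (hDm : Measurable D) {B L : ℝ} (hB : ∀ z, |D z| ≤ B) (hL : 0 ≤ L)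
    (hD : ∀ z ∈ Set.Icc (0 : Fin d → ℝ) 1, D z ≤ L * ∑ i, |z i - x i|) :
    ∫ z in Set.Icc 0 1, connection k x z * D z ≤
      (1 / 2) ^ k * (L * d * (1 - 1 / (2 * (d : ℝ))) ^ k) := by
  have hint : ∀ T : CenteredTree d k, IntegrableOn
      (fun z => (T.cell x).indicator (fun _ => (1 : ℝ)) z * D z) (Set.Icc 0 1) := fun T =>
    (integrableOn_cube_indicator_cell x T).mul_bdd hDm.aestronglyMeasurable
      (ae_of_all _ fun z => hB z)
  unfold connection
  simp_rw [Finset.sum_mul, mul_assoc]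
  rw [integral_finsetSum _ fun T _ => (hint T).const_mul _]
  calc ∑ T : CenteredTree d k, ∫ z in Set.Icc 0 1,
        T.weight * ((T.cell x).indicator (fun _ => (1 : ℝ)) z * D z)
      ≤ ∑ T : CenteredTree d k, T.weight * ((1 / 2) ^ k * (L * ∑ i, T.side 0 1 x i)) := by
        refine Finset.sum_le_sum fun T _ => ?_
        rw [integral_const_mul]
        refine mul_le_mul_of_nonneg_left ?_ T.weight_pos.le
        rw [← setIntegral_cube_indicator_cell x T, ← integral_mul_const]
        refine integral_mono (hint T) ((integrableOn_cube_indicator_cell x T).mul_const _)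
          fun z => ?_
        by_cases hz : z ∈ T.cell x
        · simp only [Set.indicator_of_mem hz, one_mul]
          refine (hD z hz.1).trans (mul_le_mul_of_nonneg_left ?_ hL)
          exact Finset.sum_le_sum fun i _ => T.abs_sub_le_side hx hz.1 hz.2 i
        · simp [Set.indicator_of_notMem hz]
    _ = (1 / 2) ^ k * L * ∑ i, ∑ T : CenteredTree d k, T.weight * T.side 0 1 x i := by
        rw [Finset.sum_comm, Finset.mul_sum]
        refine Finset.sum_congr rfl fun T _ => ?_
        rw [← Finset.mul_sum]
        ring
    _ = _ := by
        simp_rw [CenteredTree.sum_weight_side]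
        simp
        ring

end Connection

/-! ### Convergence of the finite forests -/

section Limit

variable {d k : ℕ} [NeZero d]

/-- If all trees have the right asymptotic frequency in the sequence `θ`, then the finite forests
converge to the weighted average of the observations with weights `connection k x (X i)`. If these
weights vanish, then no tree whatsoever has a data point in the cell of `x`, because all trees have
positive probability; both sides are then `0`. -/
theorem tendsto_finiteKeRF {n : ℕ} (X : Fin n → Fin d → ℝ) (Y : Fin n → ℝ)
    {θ : ℕ → CenteredTree d k} (hθ : ∀ T, Tendsto
      (fun M : ℕ => (∑ j ∈ Finset.range M, ({T} : Set _).indicator (fun _ => (1 : ℝ)) (θ j)) / M)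
      atTop (𝓝 T.weight)) (x : Fin d → ℝ) :
    Tendsto (fun M => finiteKeRF X Y θ M x) atTop
      (𝓝 ((∑ i, connection k x (X i) * Y i) / ∑ i, connection k x (X i))) := by
  have havg : ∀ F : CenteredTree d k → ℝ, Tendsto
      (fun M : ℕ => (∑ j ∈ Finset.range M, F (θ j)) / M) atTop
      (𝓝 (∑ T : CenteredTree d k, T.weight * F T)) := by
    intro F
    refine (tendsto_finsetSum _ fun T _ => (hθ T).mul_const (F T)).congr fun M => ?_
    simp_rw [div_mul_eq_mul_div, Finset.sum_mul]
    rw [← Finset.sum_div, Finset.sum_comm]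
    congr 1
    refine Finset.sum_congr rfl fun j _ => ?_
    rw [Finset.sum_eq_single (θ j)]
    · simp
    · intro T _ hT
      simp [hT.symm]
    · simp
  have hnum := havg fun T => ∑ i, Y i * (T.cell x).indicator (fun _ => (1 : ℝ)) (X i)
  have hden := havg fun T => T.count X x
  have hnum' : ∑ T : CenteredTree d k, T.weight *
      ∑ i, Y i * (T.cell x).indicator (fun _ => (1 : ℝ)) (X i) =
      ∑ i, connection k x (X i) * Y i := by
    unfold connection
    simp_rw [Finset.mul_sum, Finset.sum_mul]
    rw [Finset.sum_comm]
    exact Finset.sum_congr rfl fun i _ => Finset.sum_congr rfl fun T _ => by ring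
  have hden' : ∑ T : CenteredTree d k, T.weight * T.count X x =
      ∑ i, connection k x (X i) := by
    unfold connection CenteredTree.count
    simp_rw [Finset.mul_sum]
    rw [Finset.sum_comm]
  rw [hnum'] at hnum
  rw [hden'] at hden
  by_cases hS : ∑ i, connection k x (X i) = 0
  · have h0 : ∀ T : CenteredTree d k, T.count X x = 0 := fun T => by
      rw [← hden', Finset.sum_eq_zero_iff_of_nonneg fun T _ => mul_nonneg T.weight_pos.le
        (Finset.sum_nonneg fun i _ => Set.indicator_nonneg (fun _ _ => zero_le_one) _)] at hS
      exact (mul_eq_zero.1 (hS T (Finset.mem_univ T))).resolve_left T.weight_pos.ne'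
    have hz : ∀ M, finiteKeRF X Y θ M x = 0 := fun M => by simp [finiteKeRF, h0]
    simp_rw [hz, hS, div_zero]
    exact tendsto_const_nhds
  · refine (hnum.div hden hS).congr' ?_
    filter_upwards [eventually_gt_atTop 0] with M hM
    have hM' : (M : ℝ) ≠ 0 := Nat.cast_ne_zero.2 hM.ne'
    exact div_div_div_cancel_right₀ hM' _ _

/-- The strong law of large numbers for the frequency of every tree. -/
theorem ae_tendsto_frequency {Ω : Type*} [MeasurableSpace Ω] {P : Measure Ω}
    [IsProbabilityMeasure P] {Θ : ℕ → Ω → CenteredTree d k} (hΘ : ∀ j, Measurable (Θ j))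
    (hlaw : ∀ j, P.map (Θ j) = (CenteredTree.law d k).toMeasure) (hind : iIndepFun Θ P) :
    ∀ᵐ ω ∂P, ∀ T : CenteredTree d k, Tendsto (fun M : ℕ =>
      (∑ j ∈ Finset.range M, ({T} : Set _).indicator (fun _ => (1 : ℝ)) (Θ j ω)) / M)
      atTop (𝓝 T.weight) := by
  rw [ae_all_iff]
  intro T
  have hTm : MeasurableSet ({T} : Set (CenteredTree d k)) := trivial
  have hF : Measurable (({T} : Set (CenteredTree d k)).indicator fun _ => (1 : ℝ)) :=
    measurable_const.indicator hTm
  have hbound : ∀ S, ‖({T} : Set (CenteredTree d k)).indicator (fun _ => (1 : ℝ)) S‖ ≤ 1 :=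
    fun S => (norm_indicator_le_norm_self _ S).trans (by simp)
  have hmean : ∫ ω, ({T} : Set (CenteredTree d k)).indicator (fun _ => (1 : ℝ)) (Θ 0 ω) ∂P =
      T.weight := by
    rw [← integral_map (hΘ 0).aemeasurable hF.aestronglyMeasurable, hlaw,
      integral_indicator_const _ hTm, measureReal_def, PMF.toMeasure_apply_singleton _ _ hTm]
    simp [CenteredTree.weight]
  rw [← hmean]
  exact strong_law_ae_real
    (fun j ω => ({T} : Set (CenteredTree d k)).indicator (fun _ => (1 : ℝ)) (Θ j ω))
    (Integrable.of_bound (hF.comp (hΘ 0)).aestronglyMeasurable 1 (ae_of_all _ fun ω => hbound _))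
    (fun i j hij => (hind.indepFun hij).comp hF hF)
    (fun j => IdentDistrib.comp ⟨(hΘ j).aemeasurable, (hΘ 0).aemeasurable,
      (hlaw j).trans (hlaw 0).symm⟩ hF)

end Limit

/-! ### Risk of the infinite centered forest -/

theorem LipschitzOnCube.continuousOn {d : ℕ} {m : (Fin d → ℝ) → ℝ} (hm : LipschitzOnCube m) :
    ContinuousOn m (Set.Icc 0 1) := by
  obtain ⟨L, hL⟩ := hm
  intro x hx
  have hlim : Tendsto (fun z : Fin d → ℝ => L * ∑ j, |z j - x j|) (𝓝[Set.Icc 0 1] x) (𝓝 0) := by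
    have hc : Continuous fun z : Fin d → ℝ => L * ∑ j, |z j - x j| := by fun_prop
    have := hc.tendsto x
    simp only [sub_self, abs_zero, Finset.sum_const_zero, mul_zero] at this
    exact this.mono_left nhdsWithin_le_nhds
  refine tendsto_iff_dist_tendsto_zero.2 (squeeze_zero' (Eventually.of_forall fun _ => dist_nonneg)
    ?_ hlim)
  filter_upwards [self_mem_nhdsWithin] with z hz
  rw [Real.dist_eq]
  exact hL z hz x hx

/-- On the cube the distance between two points is at most `d`. -/
theorem sum_abs_sub_le_of_mem_cube {d : ℕ} {x z : Fin d → ℝ}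
    (hx : x ∈ Set.Icc (0 : Fin d → ℝ) 1) (hz : z ∈ Set.Icc (0 : Fin d → ℝ) 1) :
    ∑ j, |z j - x j| ≤ d := by
  calc ∑ j, |z j - x j| ≤ ∑ _j : Fin d, (1 : ℝ) := by
        refine Finset.sum_le_sum fun j _ => ?_
        have h1 := hx.1 j
        have h2 := hx.2 j
        have h3 := hz.1 j
        have h4 := hz.2 j
        simp only [Pi.zero_apply, Pi.one_apply] at h1 h2 h3 h4
        exact abs_sub_le_iff.2 ⟨by linarith, by linarith⟩
    _ = d := by simp

/-- The risk of the weighted average with weights `connection k x (X i)`: a variance term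
`2 ^ k / n` and the squared mean diameter `(1 - 1 / (2 d)) ^ (2 k)` of the cell of `x`. -/
theorem connection_average_risk_le {d : ℕ} [NeZero d] {m : (Fin d → ℝ) → ℝ} {L : ℝ} (hL0 : 0 ≤ L)
    (hL : ∀ x ∈ Set.Icc (0 : Fin d → ℝ) 1, ∀ y ∈ Set.Icc (0 : Fin d → ℝ) 1,
      |m x - m y| ≤ L * ∑ j, |x j - y j|)
    {n : ℕ} (hn : 0 < n) {Ω : Type*} [MeasurableSpace Ω] {P : Measure Ω} [IsProbabilityMeasure P]
    {X : Fin n → Ω → Fin d → ℝ} {ε Y : Fin n → Ω → ℝ} {v : ℝ≥0}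
    (hX : ∀ i, Measurable (X i)) (hε : ∀ i, Measurable (ε i))
    (hXlaw : ∀ i, pdf.IsUniform (X i) (Set.Icc 0 1) P volume)
    (hεlaw : ∀ i, P.map (ε i) = gaussianReal 0 v)
    (hXε : ∀ i, X i ⟂ᵢ[P] ε i) (hind : iIndepFun (fun i ω => (X i ω, ε i ω)) P)
    (hY : ∀ i, ∀ᵐ ω ∂P, Y i ω = m (X i ω) + ε i ω) (k : ℕ)
    {x : Fin d → ℝ} (hx : x ∈ Set.Icc (0 : Fin d → ℝ) 1) :
    Integrable (fun ω => ((∑ i, connection k x (X i ω) * Y i ω) /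
      ∑ i, connection k x (X i ω) - m x) ^ 2) P ∧
    ∫ ω, ((∑ i, connection k x (X i ω) * Y i ω) / ∑ i, connection k x (X i ω) - m x) ^ 2 ∂P ≤
      (60 * (L * d) ^ 2 + 18 * v + 3 * (|m 0| + L * d) ^ 2) *
        ((2 : ℝ) ^ k / n + (1 - 1 / (2 * (d : ℝ))) ^ (2 * k)) := by
  classical
  set Q : Set (Fin d → ℝ) := Set.Icc 0 1 with hQ
  have hQm : MeasurableSet Q := measurableSet_Icc
  have : IsProbabilityMeasure (volume.restrict Q) := ⟨by simp [hQ, volume_cube]⟩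
  have hlaw : ∀ i, P.map (X i) = volume.restrict Q := fun i => by
    rw [hXlaw i, ProbabilityTheory.cond, hQ, volume_cube, inv_one, one_smul]
  have hXQ : ∀ i, ∀ᵐ ω ∂P, X i ω ∈ Q := fun i => by
    refine ae_of_ae_map (hX i).aemeasurable ?_
    rw [hlaw i]
    exact ae_restrict_mem hQm
  -- Outside the cube nothing is known about `m`; it is replaced there by the constant `m x`.
  set g : (Fin d → ℝ) → ℝ := Q.piecewise m fun _ => m x
  have hgm : Measurable g :=
    ContinuousOn.measurable_piecewise (LipschitzOnCube.continuousOn ⟨L, hL⟩)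
      continuous_const.continuousOn hQm
  set D : (Fin d → ℝ) → ℝ := Q.indicator fun z => L * ∑ j, |z j - x j|
  have hDm : Measurable D := Measurable.indicator (by fun_prop) hQm
  have hD0 : ∀ z, 0 ≤ D z := fun z => Set.indicator_nonneg (fun z _ => by positivity) z
  have hgD : ∀ z, |g z - m x| ≤ D z := fun z => by
    by_cases hz : z ∈ Q
    · simpa [g, D, hz] using hL z hz x hx
    · simp [g, D, hz]
  have hDB : ∀ z, D z ≤ L * d := fun z => by
    by_cases hz : z ∈ Q
    · simpa [D, hz] using mul_le_mul_of_nonneg_left (sum_abs_sub_le_of_mem_cube hx hz) hL0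
    · simp only [D, Set.indicator_of_notMem hz]
      positivity
  have hp := setIntegral_cube_connection k x
  have hp0 : (0 : ℝ) < (1 / 2) ^ k := by positivity
  have hβ : ∫ z in Q, connection k x z * D z ≤
      (1 / 2) ^ k * (L * d * (1 - 1 / (2 * (d : ℝ))) ^ k) :=
    setIntegral_cube_connection_mul_le k hx hDm
      (fun z => (abs_of_nonneg (hD0 z)).trans_le (hDB z)) hL0
      fun z hz => by simp [D, Set.indicator_of_mem (show z ∈ Q from hz)]
  have hβ0 : 0 ≤ ∫ z in Q, connection k x z * D z :=
    integral_nonneg fun z => mul_nonneg (connection_nonneg k x z) (hD0 z)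
  obtain ⟨hint, hle⟩ := weighted_average_risk_le hX hε hlaw hεlaw hXε hind hn
    (measurable_connection k x) hgm hDm (connection_nonneg k x) (connection_le_one k x) hgD hDB
    (by rw [hp]; exact hp0)
  have hae : (fun ω => ((∑ i, connection k x (X i ω) * Y i ω) /
        ∑ i, connection k x (X i ω) - m x) ^ 2) =ᵐ[P]
      fun ω => ((∑ i, connection k x (X i ω) * (g (X i ω) + ε i ω)) /
        ∑ i, connection k x (X i ω) - m x) ^ 2 := by
    filter_upwards [ae_all_iff.2 hXQ, ae_all_iff.2 hY] with ω hω hYω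
    have : ∀ i, g (X i ω) + ε i ω = Y i ω := fun i => by simp [g, hω i, hYω i]
    simp_rw [this]
  refine ⟨hint.congr hae.symm, ?_⟩
  rw [integral_congr_ae hae]
  refine hle.trans ?_
  rw [hp]
  have hmx : m x ^ 2 ≤ (|m 0| + L * d) ^ 2 := by
    have h0 : (0 : Fin d → ℝ) ∈ Q := ⟨le_rfl, zero_le_one⟩
    have h1 := (hL x hx 0 h0).trans
      (mul_le_mul_of_nonneg_left (sum_abs_sub_le_of_mem_cube h0 hx) hL0)
    refine sq_le_sq.2 (le_trans ?_ (le_abs_self _))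
    linarith [abs_sub_abs_le_abs_sub (m x) (m 0)]
  have hvar : 1 / (n * (1 / 2 : ℝ) ^ k) = 2 ^ k / n := by
    rw [one_div_pow]
    field_simp
  have hbias : ((∫ z in Q, connection k x z * D z) / (1 / 2) ^ k) ^ 2 ≤
      (L * d) ^ 2 * (1 - 1 / (2 * (d : ℝ))) ^ (2 * k) := by
    have h1 : (∫ z in Q, connection k x z * D z) / (1 / 2) ^ k ≤
        L * d * (1 - 1 / (2 * (d : ℝ))) ^ k := by
      rw [div_le_iff₀ hp0]
      linarith
    refine (pow_le_pow_left₀ (div_nonneg hβ0 hp0.le) h1 2).trans_eq ?_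
    rw [mul_pow, ← pow_mul, mul_comm k 2]
  have hr0 : 0 ≤ (1 - 1 / (2 * (d : ℝ))) ^ (2 * k) := (even_two_mul k).pow_nonneg _
  have hv0 : (0 : ℝ) ≤ v := v.2
  rw [div_eq_mul_one_div, hvar]
  have hq0 : (0 : ℝ) ≤ 2 ^ k / n := by positivity
  have h1 : (36 * (L * d) ^ 2 + 18 * v + 3 * m x ^ 2) * ((2 : ℝ) ^ k / n) ≤
      (60 * (L * d) ^ 2 + 18 * v + 3 * (|m 0| + L * d) ^ 2) * ((2 : ℝ) ^ k / n) := by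
    refine mul_le_mul_of_nonneg_right ?_ hq0
    linarith [sq_nonneg (L * d)]
  have h2 : 24 * ((L * d) ^ 2 * (1 - 1 / (2 * (d : ℝ))) ^ (2 * k)) ≤
      (60 * (L * d) ^ 2 + 18 * v + 3 * (|m 0| + L * d) ^ 2) *
        (1 - 1 / (2 * (d : ℝ))) ^ (2 * k) := by
    rw [← mul_assoc]
    refine mul_le_mul_of_nonneg_right ?_ hr0
    linarith [sq_nonneg (L * d), sq_nonneg (|m 0| + L * d)]
  linarith

theorem theorem1 (d : ℕ) [NeZero d] :
    ∃ k : ℕ → ℕ, (∀ n, 1 ≤ k n) ∧ Tendsto k atTop atTop ∧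
      (∀ n : ℕ, 3 ≤ n → (k n : ℤ) =
        ⌈(1 / Real.log n - 1) /
            (2 * Real.logb 2 (1 - 1 / (2 * (d : ℝ))) - (1 - 1 / Real.log n)) *
          Real.logb 2
            ((n : ℝ) / Real.log n ^ ((1 / Real.log n) / (1 - 1 / Real.log n)))⌉) ∧
      ∀ m : (Fin d → ℝ) → ℝ, LipschitzOnCube m → ∀ v : ℝ≥0, ∃ C : ℝ,
        ∀ n : ℕ, 1 < n →
        ∀ (Ω : Type*) [MeasurableSpace Ω] (P : Measure Ω) [IsProbabilityMeasure P]
          (X : Fin n → Ω → Fin d → ℝ) (ε Y : Fin n → Ω → ℝ)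
          (Θ : ℕ → Ω → CenteredTree d (k n)),
          -- the features are uniform in the cube, the noise is centered Gaussian
          (∀ i, Measurable (X i)) → (∀ i, Measurable (ε i)) →
          (∀ i, pdf.IsUniform (X i) (Set.Icc 0 1) P volume) →
          (∀ i, P.map (ε i) = gaussianReal 0 v) →
          (∀ i, X i ⟂ᵢ[P] ε i) →
          -- the observations are independent copies of the model
          iIndepFun (fun i ω => (X i ω, ε i ω)) P →
          (∀ i, ∀ᵐ ω ∂P, Y i ω = m (X i ω) + ε i ω) →
          -- the trees are independent random centered trees, independent of the data
          (∀ j, Measurable (Θ j)) →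
          (∀ j, P.map (Θ j) = (CenteredTree.law d (k n)).toMeasure) →
          iIndepFun Θ P →
          (fun ω i => (X i ω, ε i ω)) ⟂ᵢ[P] (fun ω j => Θ j ω) →
          ∀ x ∈ Set.Icc (0 : Fin d → ℝ) 1,
            (∀ᵐ ω ∂P, ∃ l : ℝ, Tendsto
              (fun M : ℕ => finiteKeRF (fun i => X i ω) (fun i => Y i ω) (fun j => Θ j ω) M x)
              atTop (𝓝 l)) ∧
            Integrable (fun ω =>
              (infiniteKeRF (fun i => X i ω) (fun i => Y i ω) (fun j => Θ j ω) x - m x) ^ 2) P ∧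
            ∫ ω, (infiniteKeRF (fun i => X i ω) (fun i => Y i ω) (fun j => Θ j ω) x - m x) ^ 2 ∂P
              ≤ C * (n : ℝ) ^ (-(1 / (1 + (d : ℝ) * Real.log 2))) * Real.log n := by
  refine ⟨depth d, one_le_depth, tendsto_depth d, fun n hn => depth_cast_eq_ceil hn, ?_⟩
  intro m hm v
  obtain ⟨L, hL⟩ := hm
  have hL' : ∀ x ∈ Set.Icc (0 : Fin d → ℝ) 1, ∀ y ∈ Set.Icc (0 : Fin d → ℝ) 1,
      |m x - m y| ≤ |L| * ∑ j, |x j - y j| := fun x hx y hy =>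
    (hL x hx y hy).trans (mul_le_mul_of_nonneg_right (le_abs_self L)
      (Finset.sum_nonneg fun j _ => abs_nonneg _))
  obtain ⟨C₁, hC₁, hrate⟩ := exists_variance_add_bias_le d
  set C₀ := 60 * (|L| * d) ^ 2 + 18 * (v : ℝ) + 3 * (|m 0| + |L| * d) ^ 2
  have hC₀ : 0 ≤ C₀ := by positivity
  have hlog2 : 0 < Real.log 2 := Real.log_pos one_lt_two
  refine ⟨C₀ * C₁ / Real.log 2, ?_⟩
  intro n hn Ω _ P _ X ε Y Θ hX hε hXlaw hεlaw hXε hind hY hΘ hΘlaw hΘind _ x hx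
  have hlim : ∀ᵐ ω ∂P, Tendsto
      (fun M : ℕ => finiteKeRF (fun i => X i ω) (fun i => Y i ω) (fun j => Θ j ω) M x) atTop
      (𝓝 ((∑ i, connection (depth d n) x (X i ω) * Y i ω) /
        ∑ i, connection (depth d n) x (X i ω))) := by
    filter_upwards [ae_tendsto_frequency hΘ hΘlaw hΘind] with ω hω
    exact tendsto_finiteKeRF _ _ hω x
  have hae : (fun ω =>
      (infiniteKeRF (fun i => X i ω) (fun i => Y i ω) (fun j => Θ j ω) x - m x) ^ 2) =ᵐ[P]
      fun ω => ((∑ i, connection (depth d n) x (X i ω) * Y i ω) /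
        ∑ i, connection (depth d n) x (X i ω) - m x) ^ 2 := by
    filter_upwards [hlim] with ω hω
    rw [infiniteKeRF, hω.limUnder_eq]
  obtain ⟨hint, hle⟩ := connection_average_risk_le (abs_nonneg L) hL' (zero_lt_one.trans hn)
    hX hε hXlaw hεlaw hXε hind hY (depth d n) hx
  -- The factor `log n ≥ log 2` only has to absorb the constant `1 / log 2`.
  refine ⟨hlim.mono fun ω hω => ⟨_, hω⟩, hint.congr hae.symm, ?_⟩
  rw [integral_congr_ae hae]
  have hlogn : Real.log 2 ≤ Real.log n :=
    Real.log_le_log zero_lt_two (by exact_mod_cast hn)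
  set γ := -(1 / (1 + (d : ℝ) * Real.log 2))
  have hnγ : 0 ≤ (n : ℝ) ^ γ := by positivity
  calc _ ≤ C₀ * (C₁ * (n : ℝ) ^ γ) := hle.trans (mul_le_mul_of_nonneg_left (hrate n hn) hC₀)
    _ = C₀ * C₁ / Real.log 2 * (n : ℝ) ^ γ * Real.log 2 := by field_simp
    _ ≤ C₀ * C₁ / Real.log 2 * (n : ℝ) ^ γ * Real.log n := by gcongr
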